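/- Let $n\ge 1$, $q\in\mathbb N_0$ and $\kappa\in\mathbb R$. There is a constant $C>0$, depending only on $n$, $q$ and $\kappa$, such that the following holds. Let $\Omega\subset\mathbb R^n$ be open (for example a bounded polyhedral Lipschitz domain), let $f\in L^2(\Omega)$, and let $u\in H^1_0(\Omega)$ be a weak solution of $-\Delta u=f$, i.e. $\int_\Omega \nabla u\cdot\nabla v\,dx=\int_\Omega f v\,dx$ for all $v\in H^1_0(\Omega)$. Let $T$ be a closed non-degenerate $n$-simplex whose interior lies in $\Omega$ (for example a simplex of a triangulation of $\Omega$), with diameter $h_T$, whose shape satisfies $h_T\le\kappa r$ for the radius $r>0$ of some closed ball contained in $T$. Let $P_m(T)$ be the space of polynomials on $T$ of total degree at most $m$, let $\Pi_m$ be the $L^2(T)$-orthogonal projection onto $P_m(T)$, with the convention $P_{-1}(T)=\{0\}$, $\Pi_{-1}=0$, and set $\mathrm{osc}_m(f,T):=h_T\,\|(1-\Pi_m)f\|_{L^2(T)}$. Then, for every $k\in\mathbb N_0$, the minimum on the right-hand side below is attained and $$\mathrm{osc}_{k-1}^2(f,T)\;\le\; C\Big(\min_{v\in P_{k+1}(T)}\|\nabla(u-v)\|_{L^2(T)}^2+\mathrm{osc}_q^2(f,T)\Big).$$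 -/

import Mathlib

open MeasureTheory Filter Topology
open scoped ContDiff

noncomputable section

/-! ### Sobolev spaces and the Poisson problem -/

/-- Euclidean space `ℝⁿ`. -/
abbrev Rn (n : ℕ) : Type := EuclideanSpace ℝ (Fin n)

/-- `φ ∈ C_c^∞(Ω)`. -/
structure IsTestFunction {n : ℕ} (Ω : Set (Rn n)) (φ : Rn n → ℝ) : Prop where
  smooth : ContDiff ℝ ∞ φ
  compact : HasCompactSupport φ
  support_subset : tsupport φ ⊆ Ω

/-- `u ∈ H¹(Ω)` with weak gradient `g` (a representative; it is unique up to null sets). -/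
structure MemH1 {n : ℕ} (Ω : Set (Rn n)) (u : Rn n → ℝ) (g : Rn n → Rn n) : Prop where
  memLp : MemLp u 2 (volume.restrict Ω)
  memLp_grad : MemLp g 2 (volume.restrict Ω)
  weak_grad : ∀ φ : Rn n → ℝ, IsTestFunction Ω φ →
    ∫ x in Ω, u x • gradient φ x = -∫ x in Ω, φ x • g x

/-- `u ∈ H¹₀(Ω)`, the closure of `C_c^∞(Ω)` in `H¹(Ω)`, with weak gradient `g`. -/
structure MemH10 {n : ℕ} (Ω : Set (Rn n)) (u : Rn n → ℝ) (g : Rn n → Rn n) : Prop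
    extends MemH1 Ω u g where
  approx : ∃ φ : ℕ → Rn n → ℝ, (∀ j, IsTestFunction Ω (φ j)) ∧
    Tendsto (fun j => eLpNorm (fun x => u x - φ j x) 2 (volume.restrict Ω)) atTop (𝓝 0) ∧
    Tendsto (fun j => eLpNorm (fun x => g x - gradient (φ j) x) 2 (volume.restrict Ω))
      atTop (𝓝 0)

/-- `u ∈ H¹₀(Ω)`, with weak gradient `gu`, is the weak solution of `-Δu = f`:
`(∇u, ∇v)_{L²(Ω)} = (f, v)_{L²(Ω)}` for all `v ∈ H¹₀(Ω)`. -/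
structure IsWeakPoissonSolution {n : ℕ} (Ω : Set (Rn n)) (f u : Rn n → ℝ)
    (gu : Rn n → Rn n) : Prop where
  mem : MemH10 Ω u gu
  weak_eq : ∀ (v : Rn n → ℝ) (gv : Rn n → Rn n), MemH10 Ω v gv →
    ∫ x in Ω, inner ℝ (gu x) (gv x) = ∫ x in Ω, f x * v x

/-! ### Simplices -/

/-- The closed `n`-simplex in `ℝⁿ` spanned by `n + 1` affinely independent vertices. -/
def simplexSet {n : ℕ} (T : Affine.Simplex ℝ (Rn n) n) : Set (Rn n) :=
  convexHull ℝ (Set.range T.points)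

/-- The diameter `h_T`. -/
def simplexDiam {n : ℕ} (T : Affine.Simplex ℝ (Rn n) n) : ℝ := Metric.diam (simplexSet T)

/-- The simplex contains a ball of some radius `r > 0` with `h_T ≤ κ r`: the (scaling invariant)
ratio of the diameter to the inradius is at most `κ`. -/
def HasShapeRatioLE {n : ℕ} (T : Affine.Simplex ℝ (Rn n) n) (κ : ℝ) : Prop :=
  ∃ (c : Rn n) (r : ℝ), 0 < r ∧ Metric.closedBall c r ⊆ simplexSet T ∧ simplexDiam T ≤ κ * r

theorem isCompact_simplexSet {n : ℕ} (T : Affine.Simplex ℝ (Rn n) n) :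
    IsCompact (simplexSet T) :=
  (Set.finite_range T.points).isCompact_convexHull ℝ

theorem memLp_simplexSet {n : ℕ} {F : Type*} [NormedAddCommGroup F] {Ω : Set (Rn n)}
    {T : Affine.Simplex ℝ (Rn n) n} (hT : interior (simplexSet T) ⊆ Ω) {f : Rn n → F}
    (hf : MemLp f 2 (volume.restrict Ω)) : MemLp f 2 (volume.restrict (simplexSet T)) := by
  have h0 : volume (frontier (simplexSet T)) = 0 :=
    (convex_convexHull ℝ _).addHaar_frontier volume
  have h1 : volume.restrict (interior (simplexSet T)) = volume.restrict (simplexSet T) :=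
    Measure.restrict_congr_set (interior_ae_eq_of_null_frontier h0)
  rw [← h1]
  exact hf.mono_measure (Measure.restrict_mono hT le_rfl)

/-! ### Polynomials, the `L²` projection and data oscillations -/

/-- Polynomials in `n` variables all of whose monomials have total degree at most `m`; for `m < 0`
this is `{0}`. -/
def polySpace (n : ℕ) (m : ℤ) : Submodule ℝ (MvPolynomial (Fin n) ℝ) :=
  MvPolynomial.restrictSupport ℝ {s : Fin n →₀ ℕ | (s.degree : ℤ) ≤ m}

/-- The function on `ℝⁿ` given by a polynomial. -/
def polyFun {n : ℕ} (p : MvPolynomial (Fin n) ℝ) (x : Rn n) : ℝ :=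
  MvPolynomial.eval (fun i => x i) p

theorem continuous_polyFun {n : ℕ} (p : MvPolynomial (Fin n) ℝ) : Continuous (polyFun p) := by
  unfold polyFun
  exact (MvPolynomial.continuous_eval p).comp (by fun_prop)

theorem memLp_polyFun {n : ℕ} (T : Affine.Simplex ℝ (Rn n) n) (p : MvPolynomial (Fin n) ℝ) :
    MemLp (polyFun p) 2 (volume.restrict (simplexSet T)) := by
  have hK := isCompact_simplexSet T
  have : IsFiniteMeasure (volume.restrict (simplexSet T)) :=
    isFiniteMeasure_restrict.2 hK.measure_lt_top.ne
  obtain ⟨C, hC⟩ := hK.exists_bound_of_continuousOn (continuous_polyFun p).continuousOn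
  exact MemLp.of_bound (continuous_polyFun p).aestronglyMeasurable C
    (ae_restrict_of_forall_mem hK.measurableSet hC)

/-- A polynomial as an element of `L²(T)`. -/
def polyToL2 {n : ℕ} (T : Affine.Simplex ℝ (Rn n) n) :
    MvPolynomial (Fin n) ℝ →ₗ[ℝ] Lp ℝ 2 (volume.restrict (simplexSet T)) where
  toFun p := (memLp_polyFun T p).toLp (polyFun p)
  map_add' p q := by
    rw [← MemLp.toLp_add]
    congr 1
    funext x
    simp [polyFun]
  map_smul' c p := by
    rw [RingHom.id_apply, ← MemLp.toLp_const_smul]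
    congr 1
    funext x
    simp [polyFun, MvPolynomial.smul_eval]

/-- `P_m(T)` as a subspace of `L²(T)`; it is `{0}` for `m = -1`. -/
def polyL2 {n : ℕ} (T : Affine.Simplex ℝ (Rn n) n) (m : ℤ) :
    Submodule ℝ (Lp ℝ 2 (volume.restrict (simplexSet T))) :=
  (polySpace n m).map (polyToL2 T)

theorem finite_degree_le (n : ℕ) (m : ℤ) : {s : Fin n →₀ ℕ | (s.degree : ℤ) ≤ m}.Finite := by
  refine (Finsupp.finite_of_degree_le (σ := Fin n) m.toNat).subset fun s hs => ?_
  simp only [Set.mem_ofPred_eq] at hs ⊢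
  omega

instance finiteDimensional_polySpace (n : ℕ) (m : ℤ) : FiniteDimensional ℝ (polySpace n m) := by
  have : Finite {s : Fin n →₀ ℕ | (s.degree : ℤ) ≤ m} := (finite_degree_le n m).to_subtype
  exact Module.Finite.of_basis (MvPolynomial.basisRestrictSupport ℝ _)

instance finiteDimensional_polyL2 {n : ℕ} (T : Affine.Simplex ℝ (Rn n) n) (m : ℤ) :
    FiniteDimensional ℝ (polyL2 T m) :=
  Module.Finite.map (polySpace n m) (polyToL2 T)

/-- The `L²(T)`-orthogonal projection `Π_m f ∈ P_m(T)` of `f ∈ L²(T)`; `Π_{-1} = 0`. -/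
def l2Proj {n : ℕ} (T : Affine.Simplex ℝ (Rn n) n) (m : ℤ) (f : Rn n → ℝ)
    (hf : MemLp f 2 (volume.restrict (simplexSet T))) :
    Lp ℝ 2 (volume.restrict (simplexSet T)) :=
  (polyL2 T m).starProjection (hf.toLp f)

/-- The data oscillation `osc_m(f, T) = h_T ‖(1 - Π_m) f‖_{L²(T)}`. -/
def osc {n : ℕ} (T : Affine.Simplex ℝ (Rn n) n) (m : ℤ) (f : Rn n → ℝ)
    (hf : MemLp f 2 (volume.restrict (simplexSet T))) : ℝ :=
  simplexDiam T * ‖hf.toLp f - l2Proj T m f hf‖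

/-- `‖∇(u - v)‖²_{L²(T)}` for the polynomial `v`, where `gu` is the weak gradient of `u`. -/
def gradErrorSq {n : ℕ} (T : Affine.Simplex ℝ (Rn n) n) (gu : Rn n → Rn n)
    (v : MvPolynomial (Fin n) ℝ) : ℝ :=
  ∫ x in simplexSet T, ‖gu x - gradient (polyFun v) x‖ ^ 2

end

/-!
If `k - 1 ≥ q`, the projection `Π_{k-1}` is onto a larger space than `Π_q`, and
`osc_{k-1} ≤ osc_q`. So only degrees `k - 1 ≤ q` matter, which is why the constant does not depend
on `k`.

For these, let `v` have degree at most `k + 1`. Then `Δv` has degree at most `k - 1`, hence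
`osc_{k-1}(f, T) ≤ h_T ‖f + Δv‖ ≤ osc_q(f, T) + h_T ‖p‖` with `p = Π_q f + Δv`, a polynomial of
degree at most `q`. Instead of the product of the barycentric coordinates, the bubble is built from
a smooth cutoff `b` supported in the ball `B(c, r) ⊆ T` given by shape regularity, so that
`φ = b² p` is an element of `C_c^∞(Ω)` (`exists_bubble_bounds`). All norms of polynomials of degree
at most `q` on a reference ball are equivalent, and `T ⊆ B(c, κ r)`; scaling gives
`‖p‖² ≲ ∫ φ p`, `‖φ‖² ≤ ∫ φ p` and `h_T² ‖∇φ‖² ≲ ∫ φ p`. The weak equation and integration by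
parts (`integral_mul_add_polyLaplacian`) yield
`∫ φ p = ∫_T ∇(u - v) · ∇φ + ∫_T φ (Π_q f - f)`,
and the Cauchy–Schwarz inequality bounds `h_T ‖p‖` by `‖∇(u - v)‖ + osc_q(f, T)`, up to a constant
(`exists_osc_le_gradErrorSq`). The minimum over `v` is attained because the gradients of polynomials
of bounded degree form a finite-dimensional subspace of `L²(T)ⁿ`.
-/

noncomputable section

/-! ### Polynomials as functions -/

theorem contDiff_polyFun {n : ℕ} (p : MvPolynomial (Fin n) ℝ) : ContDiff ℝ ∞ (polyFun p) := by
  unfold polyFun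
  induction p using MvPolynomial.induction_on with
  | C a => simpa using contDiff_const
  | add p q hp hq => simpa using hp.add hq
  | mul_X p i hp =>
    have hX : ContDiff ℝ ∞ (fun x : Rn n => x i) := by fun_prop
    simpa using hp.mul hX

theorem differentiable_polyFun {n : ℕ} (p : MvPolynomial (Fin n) ℝ) :
    Differentiable ℝ (polyFun p) :=
  (contDiff_polyFun p).differentiable (by simp)

theorem fderiv_polyFun_single {n : ℕ} (p : MvPolynomial (Fin n) ℝ) (x : Rn n) (i : Fin n) :
    fderiv ℝ (polyFun p) x (EuclideanSpace.single i 1) = polyFun (MvPolynomial.pderiv i p) x := by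
  induction p using MvPolynomial.induction_on with
  | C a =>
    have : polyFun (MvPolynomial.C a : MvPolynomial (Fin n) ℝ) = fun _ => a := by
      funext y; simp [polyFun]
    simp [this, polyFun]
  | add p q hp hq =>
    have : polyFun (p + q) = polyFun p + polyFun q := by
      funext y; simp [polyFun]
    rw [this, fderiv_add (differentiable_polyFun p x) (differentiable_polyFun q x)]
    simp only [add_apply, hp, hq]
    simp [polyFun]
  | mul_X p j hp =>
    have : polyFun (p * MvPolynomial.X j) =
        polyFun p * fun y : Rn n => (EuclideanSpace.proj j : Rn n →L[ℝ] ℝ) y := by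
      funext y; simp [polyFun]
    rw [this, fderiv_mul (differentiable_polyFun p x)
      (ContinuousLinearMap.differentiableAt _), ContinuousLinearMap.fderiv]
    simp only [add_apply, smul_apply, hp]
    by_cases hij : j = i
    · subst hij
      simp [polyFun, MvPolynomial.pderiv_X]
    · simp [polyFun, MvPolynomial.pderiv_X, hij]

theorem polySpace_mono {n : ℕ} {a b : ℤ} (h : a ≤ b) : polySpace n a ≤ polySpace n b :=
  MvPolynomial.restrictSupport_mono ℝ fun _ hs => le_trans hs h

theorem pderiv_mem_polySpace {n : ℕ} {m : ℤ} {p : MvPolynomial (Fin n) ℝ}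
    (hp : p ∈ polySpace n m) (i : Fin n) :
    MvPolynomial.pderiv i p ∈ polySpace n (m - 1) := by
  unfold polySpace at hp
  rw [MvPolynomial.restrictSupport_eq_span] at hp
  induction hp using Submodule.span_induction with
  | mem x hx =>
    obtain ⟨s, hs, rfl⟩ := hx
    rw [MvPolynomial.pderiv_monomial]
    by_cases h0 : s i = 0
    · simp [h0]
    · refine (MvPolynomial.monomial_mem_restrictSupport ℝ).2 (Or.inl ?_)
      have h1 : Finsupp.single i 1 ≤ s := by
        simpa [Finsupp.single_le_iff] using Nat.one_le_iff_ne_zero.2 h0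
      have h2 : s.degree = (s - Finsupp.single i 1).degree + 1 := by
        conv_lhs => rw [← tsub_add_cancel_of_le h1]
        simp
      simp only [Set.mem_ofPred_eq] at hs ⊢
      omega
  | zero => simp
  | add x y _ _ hx hy => rw [map_add]; exact add_mem hx hy
  | smul a x _ hx => rw [Derivation.map_smul]; exact Submodule.smul_mem _ _ hx

/-- The Laplacian of a polynomial. -/
def polyLaplacian {n : ℕ} (p : MvPolynomial (Fin n) ℝ) : MvPolynomial (Fin n) ℝ :=
  ∑ i, MvPolynomial.pderiv i (MvPolynomial.pderiv i p)

theorem polyLaplacian_mem_polySpace {n : ℕ} {m : ℤ} {p : MvPolynomial (Fin n) ℝ}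
    (hp : p ∈ polySpace n m) : polyLaplacian p ∈ polySpace n (m - 2) := by
  refine sum_mem fun i _ => ?_
  have := pderiv_mem_polySpace (pderiv_mem_polySpace hp i) i
  rwa [show m - 1 - 1 = m - 2 by ring] at this

theorem mem_polySpace_iff_totalDegree_le {n q : ℕ} {p : MvPolynomial (Fin n) ℝ} :
    p ∈ polySpace n q ↔ p.totalDegree ≤ q := by
  rw [← MvPolynomial.mem_restrictTotalDegree]
  simp only [polySpace, MvPolynomial.restrictTotalDegree, Nat.cast_le]
  rfl

/-- The polynomial `y ↦ p (c + r y)`. -/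
def polyAffine {n : ℕ} (c : Rn n) (r : ℝ) (p : MvPolynomial (Fin n) ℝ) :
    MvPolynomial (Fin n) ℝ :=
  MvPolynomial.bind₁ (fun i => MvPolynomial.C (c i) + MvPolynomial.C r * MvPolynomial.X i) p

theorem polyFun_polyAffine {n : ℕ} (c : Rn n) (r : ℝ) (p : MvPolynomial (Fin n) ℝ) (y : Rn n) :
    polyFun (polyAffine c r p) y = polyFun p (c + r • y) := by
  unfold polyFun polyAffine
  induction p using MvPolynomial.induction_on with
  | C a => simp
  | add p q hp hq => simp [hp, hq]
  | mul_X p i hp => simp [hp]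

theorem polyAffine_mem_polySpace {n q : ℕ} {c : Rn n} {r : ℝ} {p : MvPolynomial (Fin n) ℝ}
    (hp : p ∈ polySpace n q) : polyAffine c r p ∈ polySpace n q := by
  unfold polySpace at hp
  rw [MvPolynomial.restrictSupport_eq_span] at hp
  induction hp using Submodule.span_induction with
  | mem x hx =>
    obtain ⟨s, hs, rfl⟩ := hx
    rw [mem_polySpace_iff_totalDegree_le, polyAffine, MvPolynomial.bind₁_monomial]
    have hX (i : Fin n) : (MvPolynomial.C (c i) + MvPolynomial.C r * MvPolynomial.X i :
        MvPolynomial (Fin n) ℝ).totalDegree ≤ 1 := by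
      refine (MvPolynomial.totalDegree_add _ _).trans (max_le (by simp) ?_)
      refine (MvPolynomial.totalDegree_mul _ _).trans (by simp)
    have hs' : s.degree ≤ q := by simpa using hs
    calc _ ≤ _ := MvPolynomial.totalDegree_mul _ _
      _ ≤ 0 + ∑ i ∈ s.support, s i := by
          gcongr
          · simp
          refine (MvPolynomial.totalDegree_finsetProd _ _).trans (Finset.sum_le_sum fun i _ => ?_)
          refine (MvPolynomial.totalDegree_pow _ _).trans ?_
          simpa using Nat.mul_le_mul_left (s i) (hX i)
      _ ≤ q := by rw [zero_add]; exact hs'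
  | zero => simp [polyAffine]
  | add x y _ _ hx hy => rw [polyAffine, map_add]; exact add_mem hx hy
  | smul a x _ hx => rw [polyAffine, map_smul]; exact Submodule.smul_mem _ _ hx

theorem eq_zero_of_polyFun_eq_zero_on_ball {n : ℕ} {p : MvPolynomial (Fin n) ℝ} {r : ℝ}
    (hr : 0 < r) (h : ∀ x ∈ Metric.ball (0 : Rn n) r, polyFun p x = 0) : p = 0 := by
  -- The ball contains a box, and a polynomial is determined by its values on a box.
  have h1 : Metric.ball (0 : Rn n) r ∈ 𝓝 (0 : Rn n) := Metric.ball_mem_nhds _ hr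
  have h2 : (WithLp.toLp 2 : (Fin n → ℝ) → Rn n) ⁻¹' Metric.ball (0 : Rn n) r
      ∈ 𝓝 (0 : Fin n → ℝ) :=
    (PiLp.continuous_toLp 2 _).continuousAt.preimage_mem_nhds (by simpa using h1)
  obtain ⟨ε, hε, hsub⟩ := Metric.mem_nhds_iff.1 h2
  refine MvPolynomial.funext_set (fun _ => Metric.ball (0 : ℝ) ε) (fun _ => ?_) fun x hx => ?_
  · rw [Real.ball_eq_Ioo]; exact Set.Ioo_infinite (by linarith)
  · rw [← ball_pi _ hε] at hx
    simpa [polyFun] using h _ (hsub hx)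

/-! ### Integrals of squares -/

theorem norm_toLp_sq {α E : Type*} [MeasurableSpace α] {μ : Measure α} [NormedAddCommGroup E]
    [InnerProductSpace ℝ E] {f : α → E} (hf : MemLp f 2 μ) :
    ‖hf.toLp f‖ ^ 2 = ∫ x, ‖f x‖ ^ 2 ∂μ := by
  rw [← real_inner_self_eq_norm_sq, L2.inner_def]
  refine integral_congr_ae ?_
  filter_upwards [hf.coeFn_toLp] with x hx
  rw [hx, real_inner_self_eq_norm_sq]

theorem integrable_inner_of_memLp {α E : Type*} [MeasurableSpace α] {μ : Measure α}
    [NormedAddCommGroup E] [InnerProductSpace ℝ E] {f g : α → E} (hf : MemLp f 2 μ)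
    (hg : MemLp g 2 μ) : Integrable (fun x => inner ℝ (f x) (g x)) μ := by
  refine (L2.integrable_inner (𝕜 := ℝ) (hf.toLp f) (hg.toLp g)).congr ?_
  filter_upwards [hf.coeFn_toLp, hg.coeFn_toLp] with x hx hy
  rw [hx, hy]

theorem integral_inner_le_norm_toLp_mul {α E : Type*} [MeasurableSpace α] {μ : Measure α}
    [NormedAddCommGroup E] [InnerProductSpace ℝ E] {f g : α → E} (hf : MemLp f 2 μ)
    (hg : MemLp g 2 μ) :
    ∫ x, inner ℝ (f x) (g x) ∂μ ≤ ‖hf.toLp f‖ * ‖hg.toLp g‖ := by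
  refine le_trans (le_of_eq ?_) (real_inner_le_norm (hf.toLp f) (hg.toLp g))
  rw [L2.inner_def]
  refine integral_congr_ae ?_
  filter_upwards [hf.coeFn_toLp, hg.coeFn_toLp] with x hx hy
  rw [hx, hy]

/-! ### Gradients and integration by parts -/

theorem gradient_apply {n : ℕ} (φ : Rn n → ℝ) (x : Rn n) (i : Fin n) :
    gradient φ x i = fderiv ℝ φ x (EuclideanSpace.single i 1) := by
  rw [← inner_gradient_left, EuclideanSpace.inner_single_right]
  simp

theorem continuous_gradient {n : ℕ} {φ : Rn n → ℝ} (hφ : ContDiff ℝ ∞ φ) :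
    Continuous (gradient φ) :=
  (InnerProductSpace.toDual ℝ (Rn n)).symm.continuous.comp (hφ.continuous_fderiv (by simp))

theorem hasCompactSupport_gradient {n : ℕ} {φ : Rn n → ℝ} (hφ : HasCompactSupport φ) :
    HasCompactSupport (gradient φ) :=
  (hφ.fderiv (𝕜 := ℝ)).comp_left (map_zero (InnerProductSpace.toDual ℝ (Rn n)).symm)

theorem gradient_eq_zero_of_notMem_tsupport {n : ℕ} {φ : Rn n → ℝ} {x : Rn n}
    (hx : x ∉ tsupport φ) : gradient φ x = 0 := by
  have : fderiv ℝ φ x = 0 := image_eq_zero_of_notMem_tsupport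
    fun h => hx (tsupport_fderiv_subset ℝ h)
  simp [gradient, this]

theorem gradient_comp_inv_smul_sub {n : ℕ} (ψ : Rn n → ℝ) (c x : Rn n) (r : ℝ) :
    gradient (fun y => ψ (r⁻¹ • (y - c))) x = r⁻¹ • gradient ψ (r⁻¹ • (x - c)) := by
  have h1 : fderiv ℝ (fun y => ψ (r⁻¹ • (y - c))) x =
      fderiv ℝ (fun y => ψ (r⁻¹ • y)) (x - c) := fderiv_comp_sub (f := fun y => ψ (r⁻¹ • y)) c
  have h2 : fderiv ℝ (fun y => ψ (r⁻¹ • y)) (x - c) = r⁻¹ • fderiv ℝ ψ (r⁻¹ • (x - c)) :=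
    fderiv_comp_smul r⁻¹
  simp only [gradient, h1, h2]
  simp

theorem gradient_add_of_contDiff {n : ℕ} {φ ψ : Rn n → ℝ} (hφ : ContDiff ℝ ∞ φ)
    (hψ : ContDiff ℝ ∞ ψ) (x : Rn n) :
    gradient (φ + ψ) x = gradient φ x + gradient ψ x := by
  unfold gradient
  rw [fderiv_add (hφ.differentiable (by simp) x) (hψ.differentiable (by simp) x), map_add]

theorem gradient_smul_of_contDiff {n : ℕ} {φ : Rn n → ℝ} (hφ : ContDiff ℝ ∞ φ) (a : ℝ)
    (x : Rn n) : gradient (a • φ) x = a • gradient φ x := by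
  unfold gradient
  rw [fderiv_const_smul (hφ.differentiable (by simp) x)]
  simp

theorem integral_mul_fderiv_eq_neg {n : ℕ} {φ g : Rn n → ℝ} (hφ : ContDiff ℝ ∞ φ)
    (hc : HasCompactSupport φ) (hg : ContDiff ℝ ∞ g) (v : Rn n) :
    ∫ x, φ x * fderiv ℝ g x v = -∫ x, fderiv ℝ φ x v * g x := by
  have hφ' : Continuous fun x => fderiv ℝ φ x v :=
    (hφ.continuous_fderiv (by simp)).clm_apply continuous_const
  have hg' : Continuous fun x => fderiv ℝ g x v :=
    (hg.continuous_fderiv (by simp)).clm_apply continuous_const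
  refine integral_mul_fderiv_eq_neg_fderiv_mul_of_integrable ?_ ?_ ?_
    (fun x _ => hφ.differentiable (by simp) x) (fun x _ => hg.differentiable (by simp) x)
  · exact (hφ'.mul hg.continuous).integrable_of_hasCompactSupport
      ((hc.fderiv_apply (𝕜 := ℝ) v).mul_right)
  · exact (hφ.continuous.mul hg').integrable_of_hasCompactSupport hc.mul_right
  · exact (hφ.continuous.mul hg.continuous).integrable_of_hasCompactSupport hc.mul_right

theorem integral_smul_gradient_eq_neg {n : ℕ} {φ g : Rn n → ℝ} (hφ : ContDiff ℝ ∞ φ)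
    (hc : HasCompactSupport φ) (hg : ContDiff ℝ ∞ g) :
    ∫ x, g x • gradient φ x = -∫ x, φ x • gradient g x := by
  have h1 : Integrable (fun x => g x • gradient φ x) :=
    (hg.continuous.smul (continuous_gradient hφ)).integrable_of_hasCompactSupport
      (hasCompactSupport_gradient hc).smul_left
  have h2 : Integrable (fun x => φ x • gradient g x) :=
    (hφ.continuous.smul (continuous_gradient hg)).integrable_of_hasCompactSupport
      hc.smul_right
  ext i
  have e1 := (EuclideanSpace.proj i : Rn n →L[ℝ] ℝ).integral_comp_comm h1
  have e2 := (EuclideanSpace.proj i : Rn n →L[ℝ] ℝ).integral_comp_comm h2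
  simp only [PiLp.proj_apply, PiLp.smul_apply, gradient_apply, smul_eq_mul] at e1 e2
  rw [PiLp.neg_apply, ← e1, ← e2, integral_mul_fderiv_eq_neg hφ hc hg, neg_neg]
  simp only [mul_comm]

theorem integral_mul_polyLaplacian {n : ℕ} {φ : Rn n → ℝ} (hφ : ContDiff ℝ ∞ φ)
    (hc : HasCompactSupport φ) (v : MvPolynomial (Fin n) ℝ) :
    ∫ x, φ x * polyFun (polyLaplacian v) x =
      -∫ x, inner ℝ (gradient (polyFun v) x) (gradient φ x) := by
  have hi (i : Fin n) : Integrable fun x => φ x *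
      polyFun (MvPolynomial.pderiv i (MvPolynomial.pderiv i v)) x :=
    (hφ.continuous.mul (continuous_polyFun _)).integrable_of_hasCompactSupport hc.mul_right
  have hj (i : Fin n) : Integrable fun x => fderiv ℝ φ x (EuclideanSpace.single i 1) *
      polyFun (MvPolynomial.pderiv i v) x :=
    (((hφ.continuous_fderiv (by simp)).clm_apply continuous_const).mul
      (continuous_polyFun _)).integrable_of_hasCompactSupport
      ((hc.fderiv_apply (𝕜 := ℝ) _).mul_right)
  have h1 (x : Rn n) : φ x * polyFun (polyLaplacian v) x =
      ∑ i, φ x * polyFun (MvPolynomial.pderiv i (MvPolynomial.pderiv i v)) x := by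
    simp [polyFun, polyLaplacian, Finset.mul_sum]
  have h2 (x : Rn n) : inner ℝ (gradient (polyFun v) x) (gradient φ x) =
      ∑ i, fderiv ℝ φ x (EuclideanSpace.single i 1) * polyFun (MvPolynomial.pderiv i v) x := by
    rw [PiLp.inner_apply]
    simp [-inner_gradient_left, gradient_apply, fderiv_polyFun_single]
  simp only [h1, h2]
  rw [integral_finsetSum _ fun i _ => hi i, integral_finsetSum _ fun i _ => hj i,
    ← Finset.sum_neg_distrib]
  refine Finset.sum_congr rfl fun i _ => ?_
  rw [← integral_mul_fderiv_eq_neg hφ hc (contDiff_polyFun _)]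
  simp only [fderiv_polyFun_single]

theorem memLp_of_contDiff_hasCompactSupport {n : ℕ} {φ : Rn n → ℝ} (hφ : ContDiff ℝ ∞ φ)
    (hc : HasCompactSupport φ) (μ : Measure (Rn n)) [IsFiniteMeasureOnCompacts μ] :
    MemLp φ 2 μ :=
  hφ.continuous.memLp_of_hasCompactSupport hc

theorem memLp_gradient_of_contDiff_hasCompactSupport {n : ℕ} {φ : Rn n → ℝ}
    (hφ : ContDiff ℝ ∞ φ) (hc : HasCompactSupport φ) (μ : Measure (Rn n))
    [IsFiniteMeasureOnCompacts μ] : MemLp (gradient φ) 2 μ :=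
  (continuous_gradient hφ).memLp_of_hasCompactSupport (hasCompactSupport_gradient hc)

/-- Test functions belong to `H¹₀`, with the classical gradient as weak gradient. -/
theorem IsTestFunction.memH10 {n : ℕ} {Ω : Set (Rn n)} {φ : Rn n → ℝ}
    (hφ : IsTestFunction Ω φ) : MemH10 Ω φ (gradient φ) where
  memLp := memLp_of_contDiff_hasCompactSupport hφ.smooth hφ.compact _
  memLp_grad := memLp_gradient_of_contDiff_hasCompactSupport hφ.smooth hφ.compact _
  weak_grad ψ hψ := by
    have h (x : Rn n) (hx : x ∉ Ω) : ψ x = 0 ∧ gradient ψ x = 0 :=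
      have hx' : x ∉ tsupport ψ := fun h => hx (hψ.support_subset h)
      ⟨image_eq_zero_of_notMem_tsupport hx', gradient_eq_zero_of_notMem_tsupport hx'⟩
    rw [setIntegral_eq_integral_of_forall_compl_eq_zero fun x hx => by simp [h x hx],
      setIntegral_eq_integral_of_forall_compl_eq_zero fun x hx => by simp [h x hx]]
    exact integral_smul_gradient_eq_neg hψ.smooth hψ.compact hφ.smooth
  approx := ⟨fun _ => φ, fun _ => hφ, by simp, by simp⟩

/-! ### Equivalence of norms on polynomials and scaling -/

/-- On a finite-dimensional space any seminorm `‖B ·‖` is bounded by any norm `‖A ·‖`. -/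
theorem exists_norm_le_mul_norm_of_injective {V E F : Type*} [AddCommGroup V] [Module ℝ V]
    [FiniteDimensional ℝ V] [NormedAddCommGroup E] [NormedSpace ℝ E] [NormedAddCommGroup F]
    [NormedSpace ℝ F] (A : V →ₗ[ℝ] E) (hA : Function.Injective A) (B : V →ₗ[ℝ] F) :
    ∃ C : ℝ, 0 ≤ C ∧ ∀ v, ‖B v‖ ≤ C * ‖A v‖ := by
  let e := LinearEquiv.ofInjective A hA
  have : FiniteDimensional ℝ (LinearMap.range A) := Module.Finite.range A
  let L : LinearMap.range A →L[ℝ] F := (B ∘ₗ e.symm.toLinearMap).toContinuousLinearMap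
  refine ⟨‖L‖, L.opNorm_nonneg, fun v => ?_⟩
  simpa [L, e] using L.le_opNorm (e v)

section Weighted

variable {n : ℕ} {w : Rn n → ℝ} (hw : ContDiff ℝ ∞ w) (hc : HasCompactSupport w)

/-- The map `p ↦ w p` from polynomials to `L²(ℝⁿ)` for a weight `w ∈ C_c^∞(ℝⁿ)`. -/
def weightedPolyToL2 : MvPolynomial (Fin n) ℝ →ₗ[ℝ] Lp ℝ 2 (volume : Measure (Rn n)) where
  toFun p := (memLp_of_contDiff_hasCompactSupport (hw.mul (contDiff_polyFun p))
    hc.mul_right volume).toLp (fun x => w x * polyFun p x)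
  map_add' p q := by
    rw [← MemLp.toLp_add]
    congr 1
    funext x
    simp [polyFun, mul_add]
  map_smul' a p := by
    rw [RingHom.id_apply, ← MemLp.toLp_const_smul]
    congr 1
    funext x
    simp [polyFun, MvPolynomial.smul_eval]
    ring

/-- The map `p ↦ ∇(w p)` from polynomials to `L²(ℝⁿ)ⁿ` for a weight `w ∈ C_c^∞(ℝⁿ)`. -/
def weightedPolyGradToL2 :
    MvPolynomial (Fin n) ℝ →ₗ[ℝ] Lp (Rn n) 2 (volume : Measure (Rn n)) where
  toFun p := (memLp_gradient_of_contDiff_hasCompactSupport (hw.mul (contDiff_polyFun p))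
    hc.mul_right volume).toLp (gradient fun x => w x * polyFun p x)
  map_add' p q := by
    rw [← MemLp.toLp_add]
    congr 1
    funext x
    rw [Pi.add_apply, ← gradient_add_of_contDiff (hw.mul (contDiff_polyFun p))
      (hw.mul (contDiff_polyFun q))]
    congr 1
    funext x
    simp [polyFun, mul_add]
  map_smul' a p := by
    rw [RingHom.id_apply, ← MemLp.toLp_const_smul]
    congr 1
    funext x
    rw [Pi.smul_apply, ← gradient_smul_of_contDiff (hw.mul (contDiff_polyFun p))]
    congr 1
    funext x
    simp [polyFun, MvPolynomial.smul_eval]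
    ring

theorem norm_weightedPolyToL2_sq (p : MvPolynomial (Fin n) ℝ) :
    ‖weightedPolyToL2 hw hc p‖ ^ 2 = ∫ x, (w x * polyFun p x) ^ 2 := by
  refine (norm_toLp_sq (memLp_of_contDiff_hasCompactSupport
    (hw.mul (contDiff_polyFun p)) hc.mul_right volume)).trans ?_
  simp only [Real.norm_eq_abs, sq_abs]

theorem norm_weightedPolyGradToL2_sq (p : MvPolynomial (Fin n) ℝ) :
    ‖weightedPolyGradToL2 hw hc p‖ ^ 2 = ∫ x, ‖gradient (fun y => w y * polyFun p y) x‖ ^ 2 :=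
  norm_toLp_sq (memLp_gradient_of_contDiff_hasCompactSupport (hw.mul (contDiff_polyFun p))
    hc.mul_right volume)

/-- A polynomial is determined by its product with a weight that equals one near the origin. -/
theorem weightedPolyToL2_injective {r : ℝ} (hr : 0 < r)
    (h1 : ∀ x ∈ Metric.ball (0 : Rn n) r, w x = 1) :
    Function.Injective (weightedPolyToL2 hw hc) := by
  rw [injective_iff_map_eq_zero]
  intro p hp
  have h2 : (fun x => w x * polyFun p x) =ᵐ[volume] fun _ => (0 : ℝ) := by
    have h3 := (memLp_of_contDiff_hasCompactSupport (hw.mul (contDiff_polyFun p))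
      hc.mul_right volume).coeFn_toLp
    have h4 : (weightedPolyToL2 hw hc p : Rn n → ℝ) =ᵐ[volume] fun _ => (0 : ℝ) := by
      rw [hp]; exact Lp.coeFn_zero _ _ _
    exact h3.symm.trans h4
  have h5 := (Continuous.ae_eq_iff_eq volume (hw.continuous.mul (continuous_polyFun p))
    continuous_const).1 h2
  refine eq_zero_of_polyFun_eq_zero_on_ball hr fun x hx => ?_
  simpa [h1 x hx] using congrFun h5 x

end Weighted

/-- On the unit ball there is a cutoff function `b` such that, for polynomials of degree at most
`q`, the norm `‖b p‖` controls the `L²` norm on a larger ball and the gradient of the bubble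
`b² p`: all of these are seminorms on a finite-dimensional space, and the first is a norm. -/
theorem exists_cutoff_polynomial_bounds (n q : ℕ) (R : ℝ) :
    ∃ (b : Rn n → ℝ) (C : ℝ), ContDiff ℝ ∞ b ∧ HasCompactSupport b ∧
      tsupport b ⊆ Metric.ball 0 1 ∧ (∀ x, 0 ≤ b x) ∧ (∀ x, b x ≤ 1) ∧ 0 ≤ C ∧
      ∀ p ∈ polySpace n q,
        ∫ x, ‖gradient (fun y => b y ^ 2 * polyFun p y) x‖ ^ 2 ≤
          C ^ 2 * ∫ x, (b x * polyFun p x) ^ 2 ∧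
        ∫ x in Metric.closedBall 0 R, polyFun p x ^ 2 ≤
          C ^ 2 * ∫ x, (b x * polyFun p x) ^ 2 := by
  let b : ContDiffBump (0 : Rn n) := ⟨1 / 4, 1 / 2, by norm_num, by norm_num⟩
  -- `W = 1` on `B(0, R)`, so that `‖W p‖` bounds the norm on that ball; the maximum only ensures
  -- a positive radius.
  have hR : 0 < max R 1 := lt_max_of_lt_right one_pos
  let W : ContDiffBump (0 : Rn n) := ⟨max R 1, max R 1 + 1, hR, by linarith⟩
  have hb : ContDiff ℝ ∞ b := b.contDiff
  have hbc : HasCompactSupport b := b.hasCompactSupport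
  have hb2 : ContDiff ℝ ∞ fun x => b x ^ 2 := hb.pow 2
  have hb2c : HasCompactSupport fun x => b x ^ 2 :=
    hbc.comp_left (g := fun t : ℝ => t ^ 2) (by simp)
  have hWc : HasCompactSupport W := W.hasCompactSupport
  have hinj : Function.Injective ((weightedPolyToL2 hb hbc).domRestrict (polySpace n q)) :=
    (weightedPolyToL2_injective hb hbc (r := 1 / 4) (by norm_num) fun x hx =>
      b.one_of_mem_closedBall (Metric.ball_subset_closedBall hx)).comp Subtype.val_injective
  obtain ⟨C₁, hC₁, h₁⟩ := exists_norm_le_mul_norm_of_injective _ hinj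
    ((weightedPolyGradToL2 hb2 hb2c).domRestrict (polySpace n q))
  obtain ⟨C₂, hC₂, h₂⟩ := exists_norm_le_mul_norm_of_injective _ hinj
    ((weightedPolyToL2 W.contDiff hWc).domRestrict (polySpace n q))
  refine ⟨b, max C₁ C₂, hb, hbc, ?_, fun _ => b.nonneg, fun _ => b.le_one, le_max_of_le_left hC₁,
    fun p hp => ⟨?_, ?_⟩⟩
  · rw [b.tsupport_eq]
    exact Metric.closedBall_subset_ball (by norm_num [b])
  · have h := h₁ ⟨p, hp⟩
    simp only [LinearMap.domRestrict_apply] at h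
    rw [← norm_weightedPolyGradToL2_sq hb2 hb2c, ← norm_weightedPolyToL2_sq hb hbc, ← mul_pow]
    refine pow_le_pow_left₀ (norm_nonneg _) (h.trans ?_) 2
    gcongr
    exact le_max_left _ _
  · have h := h₂ ⟨p, hp⟩
    simp only [LinearMap.domRestrict_apply] at h
    have hle : ∫ x in Metric.closedBall 0 R, polyFun p x ^ 2 ≤ ∫ x, (W x * polyFun p x) ^ 2 := by
      have hint : Integrable fun x => (W x * polyFun p x) ^ 2 :=
        (memLp_of_contDiff_hasCompactSupport (W.contDiff.mul (contDiff_polyFun p))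
          hWc.mul_right volume).integrable_sq
      refine le_trans (le_of_eq ?_) (setIntegral_le_integral (s := Metric.closedBall 0 R) hint
        (ae_of_all _ fun x => sq_nonneg _))
      refine setIntegral_congr_fun Metric.isClosed_closedBall.measurableSet fun x hx => ?_
      simp [W.one_of_mem_closedBall (Metric.closedBall_subset_closedBall (le_max_left R 1) hx)]
    refine hle.trans ?_
    rw [← norm_weightedPolyToL2_sq W.contDiff hWc, ← norm_weightedPolyToL2_sq hb hbc, ← mul_pow]
    refine pow_le_pow_left₀ (norm_nonneg _) (h.trans ?_) 2
    gcongr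
    exact le_max_right _ _

theorem integral_comp_inv_smul_sub {n : ℕ} (F : Rn n → ℝ) (c : Rn n) {r : ℝ} (hr : 0 < r) :
    ∫ x, F (r⁻¹ • (x - c)) = r ^ n * ∫ y, F y := by
  rw [integral_sub_right_eq_self (fun x => F (r⁻¹ • x)) c,
    Measure.integral_comp_inv_smul_of_nonneg volume F hr.le]
  simp

theorem setIntegral_closedBall_comp_inv_smul_sub {n : ℕ} (F : Rn n → ℝ) (c : Rn n) (R : ℝ)
    {r : ℝ} (hr : 0 < r) :
    ∫ x in Metric.closedBall c (R * r), F (r⁻¹ • (x - c)) =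
      r ^ n * ∫ y in Metric.closedBall 0 R, F y := by
  rw [← integral_indicator Metric.isClosed_closedBall.measurableSet,
    ← integral_indicator Metric.isClosed_closedBall.measurableSet,
    ← integral_comp_inv_smul_sub _ c hr]
  congr 1
  funext x
  have h : x ∈ Metric.closedBall c (R * r) ↔ r⁻¹ • (x - c) ∈ Metric.closedBall (0 : Rn n) R := by
    rw [mem_closedBall_iff_norm, mem_closedBall_zero_iff, norm_smul, norm_inv,
      Real.norm_of_nonneg hr.le, inv_mul_le_iff₀ hr, mul_comm]
  by_cases hx : x ∈ Metric.closedBall c (R * r)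
  · rw [Set.indicator_of_mem hx, Set.indicator_of_mem (h.1 hx)]
  · rw [Set.indicator_of_notMem hx, Set.indicator_of_notMem (mt h.2 hx)]

/-- The scaled bubble estimates: for a polynomial `p` of degree at most `q`, some
`φ ∈ C_c^∞(B(c, r))`, namely a squared cutoff times `p`, satisfies the bounds
`‖φ‖² ≤ ∫ φ p`, `‖∇φ‖² ≤ (C / r)² ∫ φ p` and `‖p‖²_{L²(B(c, R r))} ≤ C² ∫ φ p`,
with `C` independent of `p` and the ball. -/
theorem exists_bubble_bounds (n q : ℕ) (R : ℝ) :
    ∃ C : ℝ, 0 ≤ C ∧ ∀ (c : Rn n) (r : ℝ), 0 < r → ∀ p ∈ polySpace n q,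
      ∃ φ : Rn n → ℝ, IsTestFunction (Metric.ball c r) φ ∧
        ∫ x, φ x ^ 2 ≤ ∫ x, φ x * polyFun p x ∧
        ∫ x, ‖gradient φ x‖ ^ 2 ≤ (C / r) ^ 2 * ∫ x, φ x * polyFun p x ∧
        ∫ x in Metric.closedBall c (R * r), polyFun p x ^ 2 ≤
          C ^ 2 * ∫ x, φ x * polyFun p x := by
  obtain ⟨b, C, hb, hbc, hbs, hb0, hb1, hC, H⟩ := exists_cutoff_polynomial_bounds n q R
  refine ⟨C, hC, fun c r hr p hp => ?_⟩
  set p' := polyAffine c r p with hp'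
  obtain ⟨H₁, H₂⟩ := H p' (polyAffine_mem_polySpace hp)
  have hpp (x : Rn n) : polyFun p x = polyFun p' (r⁻¹ • (x - c)) := by
    rw [hp', polyFun_polyAffine, smul_inv_smul₀ hr.ne', add_sub_cancel]
  set ψ : Rn n → ℝ := fun y => b y ^ 2 * polyFun p' y with hψ
  have hψs : ContDiff ℝ ∞ ψ := (hb.pow 2).mul (contDiff_polyFun p')
  have hzero (y : Rn n) (hy : y ∉ tsupport b) : ψ y = 0 := by
    simp [hψ, image_eq_zero_of_notMem_tsupport hy]
  set φ : Rn n → ℝ := fun x => ψ (r⁻¹ • (x - c)) with hφ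
  have hφs : ContDiff ℝ ∞ φ := hψs.comp (by fun_prop)
  -- The support of `φ` lies in the preimage of the support of `b`.
  have hcont : Continuous fun x : Rn n => r⁻¹ • (x - c) := by fun_prop
  have hsub : tsupport φ ⊆ (fun x : Rn n => r⁻¹ • (x - c)) ⁻¹' tsupport b := by
    refine closure_minimal (fun x hx => ?_) ((isClosed_tsupport b).preimage hcont)
    by_contra h
    exact hx (hzero _ h)
  have hball : tsupport φ ⊆ Metric.ball c r := by
    intro x hx
    have h := hbs (hsub hx)
    rwa [mem_ball_zero_iff, norm_smul, norm_inv, Real.norm_of_nonneg hr.le, inv_mul_lt_iff₀ hr,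
      mul_one, ← mem_ball_iff_norm] at h
  have hφc : HasCompactSupport φ :=
    HasCompactSupport.of_support_subset_isCompact (isCompact_closedBall c r)
      ((subset_tsupport φ).trans (hball.trans Metric.ball_subset_closedBall))
  have hN : ∫ x, φ x * polyFun p x = r ^ n * ∫ y, (b y * polyFun p' y) ^ 2 := by
    rw [← integral_comp_inv_smul_sub _ c hr]
    congr 1
    funext x
    simp only [hφ, hψ, hpp]
    ring
  have hrn : 0 ≤ r ^ n := by positivity
  refine ⟨φ, ⟨hφs, hφc, hball⟩, ?_, ?_, ?_⟩
  · refine integral_mono (memLp_of_contDiff_hasCompactSupport hφs hφc volume).integrable_sq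
      ((hφs.continuous.mul (continuous_polyFun p)).integrable_of_hasCompactSupport
        hφc.mul_right) fun x => ?_
    have h0 := hb0 (r⁻¹ • (x - c))
    have h1 : b (r⁻¹ • (x - c)) ^ 2 ≤ 1 := pow_le_one₀ h0 (hb1 _)
    simp only [hφ, hψ, hpp]
    nlinarith [mul_nonneg (sq_nonneg (b (r⁻¹ • (x - c)) * polyFun p' (r⁻¹ • (x - c))))
      (sub_nonneg.2 h1)]
  · have h (x : Rn n) : ‖gradient φ x‖ ^ 2 =
        r⁻¹ ^ 2 * ‖gradient ψ (r⁻¹ • (x - c))‖ ^ 2 := by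
      simp only [hφ, gradient_comp_inv_smul_sub, norm_smul, mul_pow, norm_inv,
        Real.norm_of_nonneg hr.le]
    simp only [h]
    rw [integral_const_mul, integral_comp_inv_smul_sub (fun y => ‖gradient ψ y‖ ^ 2) c hr, hN]
    calc r⁻¹ ^ 2 * (r ^ n * ∫ y, ‖gradient ψ y‖ ^ 2)
        ≤ r⁻¹ ^ 2 * (r ^ n * (C ^ 2 * ∫ y, (b y * polyFun p' y) ^ 2)) := by gcongr
      _ = _ := by ring
  · simp only [hpp]
    rw [setIntegral_closedBall_comp_inv_smul_sub (fun y => polyFun p' y ^ 2) c R hr]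
    simp only [← hpp]
    rw [hN]
    calc _ ≤ r ^ n * (C ^ 2 * ∫ y, (b y * polyFun p' y) ^ 2) := by gcongr
      _ = _ := by ring

/-! ### Best approximation on the simplex -/

theorem norm_sub_starProjection_le {E : Type*} [NormedAddCommGroup E] [InnerProductSpace ℝ E]
    (U : Submodule ℝ E) [U.HasOrthogonalProjection] (y : E) {x : E} (hx : x ∈ U) :
    ‖y - U.starProjection y‖ ≤ ‖y - x‖ := by
  rw [U.starProjection_minimal]
  exact ciInf_le ⟨0, Set.forall_mem_range.2 fun _ => norm_nonneg _⟩ (⟨x, hx⟩ : U)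

section Simplex

variable {n : ℕ} (T : Affine.Simplex ℝ (Rn n) n)

theorem memLp_gradient_polyFun (p : MvPolynomial (Fin n) ℝ) :
    MemLp (gradient (polyFun p)) 2 (volume.restrict (simplexSet T)) := by
  have hK := isCompact_simplexSet T
  have : IsFiniteMeasure (volume.restrict (simplexSet T)) :=
    isFiniteMeasure_restrict.2 hK.measure_lt_top.ne
  have hc := continuous_gradient (contDiff_polyFun p)
  obtain ⟨C, hC⟩ := hK.exists_bound_of_continuousOn hc.continuousOn
  exact MemLp.of_bound hc.aestronglyMeasurable C (ae_restrict_of_forall_mem hK.measurableSet hC)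

/-- The gradient of a polynomial as an element of `L²(T)ⁿ`. -/
def polyGradToL2 :
    MvPolynomial (Fin n) ℝ →ₗ[ℝ] Lp (Rn n) 2 (volume.restrict (simplexSet T)) where
  toFun p := (memLp_gradient_polyFun T p).toLp (gradient (polyFun p))
  map_add' p q := by
    rw [← MemLp.toLp_add]
    congr 1
    funext x
    rw [Pi.add_apply, ← gradient_add_of_contDiff (contDiff_polyFun p) (contDiff_polyFun q)]
    congr 1
    funext x
    simp [polyFun]
  map_smul' a p := by
    rw [RingHom.id_apply, ← MemLp.toLp_const_smul]
    congr 1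
    funext x
    rw [Pi.smul_apply, ← gradient_smul_of_contDiff (contDiff_polyFun p)]
    congr 1
    funext x
    simp [polyFun, MvPolynomial.smul_eval]

variable {T}

theorem gradErrorSq_eq_norm_sq {gu : Rn n → Rn n}
    (hgu : MemLp gu 2 (volume.restrict (simplexSet T))) (v : MvPolynomial (Fin n) ℝ) :
    gradErrorSq T gu v = ‖hgu.toLp gu - polyGradToL2 T v‖ ^ 2 :=
  (norm_toLp_sq (hgu.sub (memLp_gradient_polyFun T v))).symm

/-- The minimum of the gradient error is attained at the orthogonal projection of the gradient to
the finite-dimensional space of polynomial gradients. -/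
theorem exists_isLeast_gradErrorSq {gu : Rn n → Rn n}
    (hgu : MemLp gu 2 (volume.restrict (simplexSet T))) (m : ℤ) :
    ∃ M : ℝ, IsLeast (gradErrorSq T gu '' (polySpace n m)) M := by
  let W := (polySpace n m).map (polyGradToL2 T)
  have : FiniteDimensional ℝ W := Module.Finite.map (polySpace n m) (polyGradToL2 T)
  obtain ⟨v₀, hv₀, h⟩ := Submodule.mem_map.1 (W.starProjection_apply_mem (hgu.toLp gu))
  refine ⟨gradErrorSq T gu v₀, ⟨v₀, hv₀, rfl⟩, ?_⟩
  rintro _ ⟨v, hv, rfl⟩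
  rw [gradErrorSq_eq_norm_sq hgu, gradErrorSq_eq_norm_sq hgu, h]
  exact pow_le_pow_left₀ (norm_nonneg _)
    (norm_sub_starProjection_le W _ (Submodule.mem_map_of_mem hv)) 2

theorem gradErrorSq_nonneg (gu : Rn n → Rn n) (v : MvPolynomial (Fin n) ℝ) :
    0 ≤ gradErrorSq T gu v :=
  integral_nonneg fun _ => by positivity

theorem osc_nonneg {m : ℤ} {f : Rn n → ℝ} (hf : MemLp f 2 (volume.restrict (simplexSet T))) :
    0 ≤ osc T m f hf :=
  mul_nonneg Metric.diam_nonneg (norm_nonneg _)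

theorem osc_le_diam_mul_norm_sub {m : ℤ} {f : Rn n → ℝ}
    (hf : MemLp f 2 (volume.restrict (simplexSet T))) {g : Lp ℝ 2 (volume.restrict (simplexSet T))}
    (hg : g ∈ polyL2 T m) : osc T m f hf ≤ simplexDiam T * ‖hf.toLp f - g‖ :=
  mul_le_mul_of_nonneg_left (norm_sub_starProjection_le _ _ hg) Metric.diam_nonneg

theorem osc_antitone {a b : ℤ} (h : a ≤ b) {f : Rn n → ℝ}
    (hf : MemLp f 2 (volume.restrict (simplexSet T))) : osc T b f hf ≤ osc T a f hf :=
  osc_le_diam_mul_norm_sub hf (Submodule.map_mono (polySpace_mono h)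
    ((polyL2 T a).starProjection_apply_mem _))

/-! ### The residual estimate -/

/-- Testing the equation with a function supported inside the simplex and integrating by parts. -/
theorem integral_mul_add_polyLaplacian {Ω : Set (Rn n)} {f u : Rn n → ℝ} {gu : Rn n → Rn n}
    (hu : IsWeakPoissonSolution Ω f u gu) (hf : MemLp f 2 (volume.restrict Ω))
    (hT : interior (simplexSet T) ⊆ Ω) {φ : Rn n → ℝ}
    (hφ : IsTestFunction (interior (simplexSet T)) φ) (v : MvPolynomial (Fin n) ℝ) :
    ∫ x in simplexSet T, φ x * (f x + polyFun (polyLaplacian v) x) =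
      ∫ x in simplexSet T, inner ℝ (gu x - gradient (polyFun v) x) (gradient φ x) := by
  have hφΩ : IsTestFunction Ω φ := ⟨hφ.smooth, hφ.compact, hφ.support_subset.trans hT⟩
  have hzero (x : Rn n) (hx : x ∉ simplexSet T) : φ x = 0 ∧ gradient φ x = 0 :=
    have hx' : x ∉ tsupport φ := fun h => hx (interior_subset (hφ.support_subset h))
    ⟨image_eq_zero_of_notMem_tsupport hx', gradient_eq_zero_of_notMem_tsupport hx'⟩
  have hzeroΩ (x : Rn n) (hx : x ∉ Ω) : φ x = 0 ∧ gradient φ x = 0 :=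
    have hx' : x ∉ tsupport φ := fun h => hx (hφΩ.support_subset h)
    ⟨image_eq_zero_of_notMem_tsupport hx', gradient_eq_zero_of_notMem_tsupport hx'⟩
  have h1 : ∫ x in simplexSet T, φ x * f x =
      ∫ x in simplexSet T, inner ℝ (gu x) (gradient φ x) := by
    have h := hu.weak_eq φ (gradient φ) hφΩ.memH10
    rw [setIntegral_eq_integral_of_forall_compl_eq_zero fun x hx => by rw [(hzeroΩ x hx).2]; simp,
      setIntegral_eq_integral_of_forall_compl_eq_zero fun x hx => by simp [hzeroΩ x hx]] at h
    rw [setIntegral_eq_integral_of_forall_compl_eq_zero fun x hx => by simp [hzero x hx],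
      setIntegral_eq_integral_of_forall_compl_eq_zero fun x hx => by rw [(hzero x hx).2]; simp, h]
    simp only [mul_comm]
  have h2 : ∫ x in simplexSet T, φ x * polyFun (polyLaplacian v) x =
      -∫ x in simplexSet T, inner ℝ (gradient (polyFun v) x) (gradient φ x) := by
    rw [setIntegral_eq_integral_of_forall_compl_eq_zero fun x hx => by simp [hzero x hx],
      setIntegral_eq_integral_of_forall_compl_eq_zero fun x hx => by rw [(hzero x hx).2]; simp]
    exact integral_mul_polyLaplacian hφ.smooth hφ.compact v
  have hφL := memLp_of_contDiff_hasCompactSupport hφ.smooth hφ.compact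
    (volume.restrict (simplexSet T))
  have hgφL := memLp_gradient_of_contDiff_hasCompactSupport hφ.smooth hφ.compact
    (volume.restrict (simplexSet T))
  have hguT := memLp_simplexSet hT hu.mem.memLp_grad
  have hi1 : Integrable (fun x => φ x * f x) (volume.restrict (simplexSet T)) :=
    hφL.integrable_mul (memLp_simplexSet hT hf)
  have hi2 : Integrable (fun x => φ x * polyFun (polyLaplacian v) x)
      (volume.restrict (simplexSet T)) := hφL.integrable_mul (memLp_polyFun T _)
  simp only [mul_add, inner_sub_left]
  rw [integral_add hi1 hi2, integral_sub (integrable_inner_of_memLp hguT hgφL)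
      (integrable_inner_of_memLp (memLp_gradient_polyFun T v) hgφL), h1, h2, sub_eq_add_neg]

theorem simplexSet_subset_closedBall {c : Rn n} {r κ : ℝ} (hr : 0 ≤ r)
    (hball : Metric.closedBall c r ⊆ simplexSet T) (hκ : simplexDiam T ≤ κ * r) :
    simplexSet T ⊆ Metric.closedBall c (κ * r) := fun _ hx =>
  (Metric.dist_le_diam_of_mem (isCompact_simplexSet T).isBounded hx
    (hball (Metric.mem_closedBall_self hr))).trans hκ

end Simplex

/-- For `v` of degree at most `m + 2` the oscillation `osc_m(f, T)` is at most `h_T` times the norm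
of the residual `f + Δv`, because `Δv` has degree at most `m`. The polynomial part `Π_q f + Δv` of
the residual is bounded by testing the equation with its bubble. -/
theorem exists_osc_le_gradErrorSq (n q : ℕ) (κ : ℝ) :
    ∃ A : ℝ, 0 ≤ A ∧ ∀ (Ω : Set (Rn n)) (f : Rn n → ℝ) (hf : MemLp f 2 (volume.restrict Ω))
      (u : Rn n → ℝ) (gu : Rn n → Rn n) (_ : IsWeakPoissonSolution Ω f u gu)
      (T : Affine.Simplex ℝ (Rn n) n) (hT : interior (simplexSet T) ⊆ Ω)
      (_ : HasShapeRatioLE T κ) (m : ℤ) (_ : m ≤ q),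
      ∀ v ∈ polySpace n (m + 2),
        osc T m f (memLp_simplexSet hT hf) ≤
          A * (√(gradErrorSq T gu v) + osc T (q : ℤ) f (memLp_simplexSet hT hf)) := by
  obtain ⟨C, hC, H⟩ := exists_bubble_bounds n q κ
  refine ⟨max (C * (C * κ)) (1 + C), le_max_of_le_right (by linarith), ?_⟩
  intro Ω f hf u gu hu T hT ⟨c, r, hr, hball, hκ⟩ m hm v hv
  have hfT := memLp_simplexSet hT hf
  have hguT := memLp_simplexSet hT hu.mem.memLp_grad
  set μ := volume.restrict (simplexSet T)
  have hh : 0 ≤ simplexDiam T := Metric.diam_nonneg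
  obtain ⟨p₀, hp₀, hproj⟩ := Submodule.mem_map.1
    ((polyL2 T (q : ℤ)).starProjection_apply_mem (hfT.toLp f))
  -- The polynomial part of the residual.
  have hΔm : polyLaplacian v ∈ polySpace n m := by
    simpa using polyLaplacian_mem_polySpace hv
  set p := p₀ + polyLaplacian v with hp
  have hpq : p ∈ polySpace n q := add_mem hp₀ (polySpace_mono hm hΔm)
  obtain ⟨φ, hφ, hφ2, hgφ2, hp2⟩ := H c r hr p hpq
  have hφT : IsTestFunction (interior (simplexSet T)) φ :=
    ⟨hφ.smooth, hφ.compact, hφ.support_subset.trans (interior_maximal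
      (Metric.ball_subset_closedBall.trans hball) Metric.isOpen_ball)⟩
  have hφL := memLp_of_contDiff_hasCompactSupport hφ.smooth hφ.compact μ
  have hgφL := memLp_gradient_of_contDiff_hasCompactSupport hφ.smooth hφ.compact μ
  set D := ‖hfT.toLp f - polyToL2 T p₀‖ with hD
  set E := ‖hguT.toLp gu - polyGradToL2 T v‖ with hE
  have hosc : osc T (q : ℤ) f hfT = simplexDiam T * D := by
    rw [hD, hproj]; rfl
  have hEsqrt : √(gradErrorSq T gu v) = E := by
    rw [gradErrorSq_eq_norm_sq hguT, Real.sqrt_sq (norm_nonneg _)]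
  have hN0 : 0 ≤ ∫ x, φ x * polyFun p x :=
    (integral_nonneg fun x => sq_nonneg (φ x)).trans hφ2
  -- The natural norm of the bubble: `N² = ∫ φ p`.
  set N := √(∫ x, φ x * polyFun p x) with hN
  have hNsq : N ^ 2 = ∫ x, φ x * polyFun p x := Real.sq_sqrt hN0
  have hNnn : 0 ≤ N := Real.sqrt_nonneg _
  rw [← hNsq] at hφ2 hgφ2 hp2
  have hφN : ‖hφL.toLp φ‖ ≤ N := by
    refine le_of_sq_le_sq ?_ hNnn
    rw [norm_toLp_sq]
    simp only [Real.norm_eq_abs, sq_abs]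
    exact (setIntegral_le_integral
      (memLp_of_contDiff_hasCompactSupport hφ.smooth hφ.compact volume).integrable_sq
      (ae_of_all _ fun x => sq_nonneg _)).trans hφ2
  have hgφN : ‖hgφL.toLp (gradient φ)‖ ≤ C / r * N := by
    refine le_of_sq_le_sq ?_ (by positivity)
    rw [norm_toLp_sq, mul_pow]
    exact (setIntegral_le_integral
      (memLp_two_iff_integrable_sq_norm (continuous_gradient hφ.smooth).aestronglyMeasurable |>.1
        (memLp_gradient_of_contDiff_hasCompactSupport hφ.smooth hφ.compact volume))
      (ae_of_all _ fun x => sq_nonneg _)).trans hgφ2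
  have hpN : ‖polyToL2 T p‖ ≤ C * N := by
    refine le_of_sq_le_sq ?_ (by positivity)
    refine (norm_toLp_sq (memLp_polyFun T p)).trans_le ?_
    rw [mul_pow]
    simp only [Real.norm_eq_abs, sq_abs]
    exact (setIntegral_mono_set
      (((continuous_polyFun p).pow 2).continuousOn.integrableOn_compact
        (isCompact_closedBall c (κ * r)))
      (ae_of_all _ fun x => sq_nonneg _)
      (simplexSet_subset_closedBall hr.le hball hκ).eventuallyLE).trans hp2
  have hNle : N ≤ D + C / r * E := by
    have h1 : N ^ 2 = ∫ x in simplexSet T, φ x * polyFun p x := by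
      rw [hNsq, setIntegral_eq_integral_of_forall_compl_eq_zero fun x hx => ?_]
      rw [image_eq_zero_of_notMem_tsupport
        fun h => hx (interior_subset (hφT.support_subset h)), zero_mul]
    -- `p = (f + Δv) - (f - Π_q f)`
    have hsplit (x : Rn n) : φ x * polyFun p x =
        φ x * (f x + polyFun (polyLaplacian v) x) - inner ℝ (f x - polyFun p₀ x) (φ x) := by
      simp only [hp, polyFun, map_add, RCLike.inner_apply, conj_trivial]
      ring
    have hpL := memLp_polyFun T p₀
    have h2 := integral_inner_le_norm_toLp_mul (hpL.sub hfT) hφL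
    have h3 := integral_inner_le_norm_toLp_mul (hguT.sub (memLp_gradient_polyFun T v)) hgφL
    have h4 := integral_mul_add_polyLaplacian hu hf hT hφT v
    have h5 : N ^ 2 ≤ D * N + E * (C / r * N) := by
      rw [h1]
      simp only [hsplit]
      have hi1 : Integrable (fun x => φ x * (f x + polyFun (polyLaplacian v) x))
          (volume.restrict (simplexSet T)) := hφL.integrable_mul (hfT.add (memLp_polyFun T _))
      have hi2 : Integrable (fun x => inner ℝ (f x - polyFun p₀ x) (φ x))
          (volume.restrict (simplexSet T)) := integrable_inner_of_memLp (hfT.sub hpL) hφL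
      rw [integral_sub hi1 hi2, h4]
      have h6 : -∫ x in simplexSet T, inner ℝ (f x - polyFun p₀ x) (φ x) =
          ∫ x in simplexSet T, inner ℝ ((polyFun p₀ - f) x) (φ x) := by
        rw [← integral_neg]
        congr 1
        funext x
        rw [← inner_neg_left, neg_sub, Pi.sub_apply]
      have h7 : ‖(hpL.sub hfT).toLp (polyFun p₀ - f)‖ = D := by
        rw [MemLp.toLp_sub hpL hfT, norm_sub_rev]; rfl
      rw [sub_eq_add_neg, h6, add_comm]
      refine add_le_add (h2.trans ?_) (h3.trans ?_)
      · rw [h7]; gcongr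
      · rw [MemLp.toLp_sub hguT (memLp_gradient_polyFun T v)]
        exact mul_le_mul_of_nonneg_left hgφN (norm_nonneg _)
    rcases hNnn.eq_or_lt with h0 | h0
    · rw [← h0]; positivity
    · refine le_of_mul_le_mul_right ?_ h0
      linarith
  have hκr : simplexDiam T / r ≤ κ := (div_le_iff₀ hr).2 hκ
  have hmem : -polyToL2 T (polyLaplacian v) ∈ polyL2 T m :=
    neg_mem (Submodule.mem_map_of_mem hΔm)
  rw [hEsqrt, hosc]
  calc osc T m f hfT
      ≤ simplexDiam T * ‖hfT.toLp f - -polyToL2 T (polyLaplacian v)‖ :=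
        osc_le_diam_mul_norm_sub hfT hmem
    _ ≤ simplexDiam T * (D + C * N) := by
        gcongr
        have : hfT.toLp f - -polyToL2 T (polyLaplacian v) =
            (hfT.toLp f - polyToL2 T p₀) + polyToL2 T p := by
          rw [hp, map_add]; abel
        rw [this]
        exact (norm_add_le _ _).trans (by gcongr)
    _ ≤ simplexDiam T * (D + C * (D + C / r * E)) := by gcongr
    _ = C * (C * (simplexDiam T / r)) * E + (1 + C) * (simplexDiam T * D) := by
        field_simp
        ring
    _ ≤ C * (C * κ) * E + (1 + C) * (simplexDiam T * D) := by gcongr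
    _ ≤ max (C * (C * κ)) (1 + C) * E + max (C * (C * κ)) (1 + C) * (simplexDiam T * D) := by
        gcongr
        · exact le_max_left _ _
        · exact le_max_right _ _
    _ = _ := by ring

end

theorem mainTheorem7 (n : ℕ) (hn : 1 ≤ n) (q : ℕ) (κ : ℝ) :
    ∃ C : ℝ, 0 < C ∧
      ∀ (Ω : Set (Rn n)) (_ : IsOpen Ω)
        (f : Rn n → ℝ) (hf : MemLp f 2 (volume.restrict Ω))
        (u : Rn n → ℝ) (gu : Rn n → Rn n) (_ : IsWeakPoissonSolution Ω f u gu)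
        (T : Affine.Simplex ℝ (Rn n) n) (hT : interior (simplexSet T) ⊆ Ω)
        (_ : HasShapeRatioLE T κ) (k : ℕ),
        ∃ M : ℝ, IsLeast (gradErrorSq T gu '' (polySpace n ((k : ℤ) + 1))) M ∧
          osc T ((k : ℤ) - 1) f (memLp_simplexSet hT hf) ^ 2 ≤
            C * (M + osc T (q : ℤ) f (memLp_simplexSet hT hf) ^ 2) := by
  obtain ⟨A, hA, H⟩ := exists_osc_le_gradErrorSq n q κ
  refine ⟨2 * A ^ 2 + 1, by positivity, ?_⟩
  intro Ω _ f hf u gu hu T hT hκ k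
  obtain ⟨M, hM⟩ := exists_isLeast_gradErrorSq (memLp_simplexSet hT hu.mem.memLp_grad)
    ((k : ℤ) + 1)
  refine ⟨M, hM, ?_⟩
  obtain ⟨v, hv, rfl⟩ := hM.1
  have hG := gradErrorSq_nonneg (T := T) gu v
  have hfT := memLp_simplexSet hT hf
  have hq : 0 ≤ osc T (q : ℤ) f hfT := osc_nonneg hfT
  have hk : 0 ≤ osc T ((k : ℤ) - 1) f hfT := osc_nonneg hfT
  rcases le_total ((k : ℤ) - 1) q with hkq | hkq
  · have h := H Ω f hf u gu hu T hT hκ ((k : ℤ) - 1) hkq v (by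
      rwa [show (k : ℤ) - 1 + 2 = k + 1 by ring])
    calc osc T ((k : ℤ) - 1) f hfT ^ 2
        ≤ (A * (√(gradErrorSq T gu v) + osc T (q : ℤ) f hfT)) ^ 2 := pow_le_pow_left₀ hk h 2
      _ ≤ A ^ 2 * (2 * (√(gradErrorSq T gu v) ^ 2 + osc T (q : ℤ) f hfT ^ 2)) := by
          rw [mul_pow]
          gcongr
          exact add_sq_le
      _ ≤ _ := by
          rw [Real.sq_sqrt hG]
          nlinarith [sq_nonneg (osc T (q : ℤ) f hfT)]
  · -- Here `Π_{k-1}` projects onto a larger space than `Π_q`.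
    calc osc T ((k : ℤ) - 1) f hfT ^ 2
        ≤ osc T (q : ℤ) f hfT ^ 2 := pow_le_pow_left₀ hk (osc_antitone hkq hfT) 2
      _ ≤ 1 * (gradErrorSq T gu v + osc T (q : ℤ) f hfT ^ 2) := by linarith
      _ ≤ _ := by gcongr; nlinarith [sq_nonneg A]
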